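/- A recollement $(\mathscr A,\mathscr B,\mathscr C)$ of abelian categories consists of additive functors $\mathsf q\colon\mathscr B\to\mathscr A$, $\mathsf i\colon\mathscr A\to\mathscr B$, $\mathsf p\colon\mathscr B\to\mathscr A$, $\mathsf l\colon\mathscr C\to\mathscr B$, $\mathsf e\colon\mathscr B\to\mathscr C$, $\mathsf r\colon\mathscr C\to\mathscr B$ such that $(\mathsf q,\mathsf i,\mathsf p)$ and $(\mathsf l,\mathsf e,\mathsf r)$ are adjoint triples, $\mathsf i,\mathsf l,\mathsf r$ are fully faithful, and the essential image of $\mathsf i$ is $\operatorname{Ker}\mathsf e=\{B\in\mathscr B\mid \mathsf e(B)=0\}$. A recollement of triangulated categories is defined in the same way, with triangle functors and adjunctions of triangle functors. Put $\mathsf l^0=\mathsf l$ and $\mathsf r^0=\mathsf r$. The recollement of abelian categories admits a ladder of $\mathsf l$-height $n$ if there are additive functors $\mathsf l^1,\dots,\mathsf l^{n-1}$ (alternately $\mathscr B\to\mathscr C$ and $\mathscr C\to\mathscr B$) such that $\mathsf l^{j+1}$ is left adjoint to $\mathsf l^{j}$ for $0\le j\le n-2$; it admits a ladder of $\mathsf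 r$-height $n$ if there are additive functors $\mathsf r^1,\dots,\mathsf r^{n-1}$ such that $\mathsf r^{j+1}$ is right adjoint to $\mathsf r^{j}$ for $0\le j\le n-2$. For a class $\mathcal X$ of objects of $\mathscr B$ put $\mathcal X^{\perp}=\{Y\mid \operatorname{Hom}(X,Y)=0\ \forall X\in\mathcal X\}$ and ${}^{\perp}\mathcal X=\{Y\mid \operatorname{Hom}(Y,X)=0\ \forall X\in\mathcal X\}$. A torsion pair in $\mathscr B$ is a pair $(\mathcal X,\mathcal Y)$ of full subcategories such that $\operatorname{Hom}(\mathcal X,\mathcal Y)=0$ and every object $B$ of $\mathscr B$ admits a short exact sequence $0\to X\to B\to Y\to 0$ with $X\in\mathcal X$, $Y\in\mathcal Y$. Let $\mathsf D(-)$ be the derived category, $\mathsf D^{b}(-)$ the bounded derived category (as a full subcategory of $\mathsf D(-)$), $\mathsf D_{\mathscr A}(\mathscr B)$ the full subcategory of $\mathsf D(\mathscr B)$ of the objects all of whose cohomologies lie in the essential image of $\mathsf i$, and $\mathsf D^{b}_{\mathscr A}(\mathscr B)=\mathsf D_{\mathscr A}(\mathscr B)\cap \mathsf D^{b}(\mathscr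 B)$. **Proposition.** Let $(\mathscr A,\mathscr B,\mathscr C)$ be a recollement of abelian categories. (i) Assume that $\mathscr B$ is well-powered and cocomplete (has small coproducts) and that the recollement admits a ladder of $\mathsf l$-height two. Then $(\operatorname{Ker}\mathsf l^1,(\operatorname{Ker}\mathsf l^1)^{\perp})$ is a torsion pair in $\mathscr B$. (ii) Assume that the recollement admits a ladder of $\mathsf l$-height three. Then there is a recollement of abelian categories $(\operatorname{Ker}\mathsf l^1,\mathscr B,\mathscr C)$ given by the inclusion $\operatorname{Ker}\mathsf l^1\to\mathscr B$ and the adjoint triple $(\mathsf l^2,\mathsf l^1,\mathsf l^0)$. Moreover $\mathsf l^1,\mathsf l^0,\mathsf e$ are exact, and there is a recollement of triangulated categories $(\mathsf D(\mathscr C),\mathsf D(\mathscr B),\mathsf D_{\mathscr A}(\mathscr B))$ whose adjoint triple between $\mathsf D(\mathscr C)$ and $\mathsf D(\mathscr B)$ consists of the functors induced by $(\mathsf l^1,\mathsf l^0,\mathsf e)$; it restricts to a recollement $(\mathsf D^{b}(\mathscr C),\mathsf D^{b}(\mathscr B),\mathsf D^{b}_{\mathscr A}(\mathscr B))$. (iii)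 Assume that $\mathscr B$ is well-powered and complete (has small products) and that the recollement admits a ladder of $\mathsf r$-height two. Then $({}^{\perp}(\operatorname{Ker}\mathsf r^1),\operatorname{Ker}\mathsf r^1)$ is a torsion pair in $\mathscr B$. (iv) Assume that the recollement admits a ladder of $\mathsf r$-height three. Then there is a recollement of abelian categories $(\operatorname{Ker}\mathsf r^1,\mathscr B,\mathscr C)$ given by the inclusion $\operatorname{Ker}\mathsf r^1\to\mathscr B$ and the adjoint triple $(\mathsf r^0,\mathsf r^1,\mathsf r^2)$. Moreover $\mathsf e,\mathsf r^0,\mathsf r^1$ are exact, and there is a recollement of triangulated categories $(\mathsf D(\mathscr C),\mathsf D(\mathscr B),\mathsf D_{\mathscr A}(\mathscr B))$ whose adjoint triple between $\mathsf D(\mathscr C)$ and $\mathsf D(\mathscr B)$ consists of the functors induced by $(\mathsf e,\mathsf r^0,\mathsf r^1)$; it restricts to a recollement $(\mathsf D^{b}(\mathscr C),\mathsf D^{b}(\mathscr B),\mathsf D^{b}_{\mathscr A}(\mathscr B))$. -/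

import Mathlib

open CategoryTheory CategoryTheory.Limits CategoryTheory.Pretriangulated

universe v₁ v₂ v₃ u₁ u₂ u₃ w₂ w₃

namespace RecollementLadder

/-- A functor between abelian categories is exact: it is additive and it preserves finite limits
and finite colimits. -/
class IsExactFunctor {X : Type u₁} {Y : Type u₂} [Category.{v₁} X] [Category.{v₂} Y]
    [Abelian X] [Abelian Y] (F : X ⥤ Y) : Prop where
  additive : F.Additive
  preservesFiniteLimits : PreservesFiniteLimits F
  preservesFiniteColimits : PreservesFiniteColimits F

attribute [instance] IsExactFunctor.additive IsExactFunctor.preservesFiniteLimits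
  IsExactFunctor.preservesFiniteColimits

/-- A recollement of abelian categories `(A, B, C)`. -/
structure AbelianRecollement (A : Type u₁) (B : Type u₂) (C : Type u₃)
    [Category.{v₁} A] [Category.{v₂} B] [Category.{v₃} C] [Abelian A] [Abelian B] [Abelian C] where
  q : B ⥤ A
  i : A ⥤ B
  p : B ⥤ A
  l : C ⥤ B
  e : B ⥤ C
  r : C ⥤ B
  q_additive : q.Additive
  i_additive : i.Additive
  p_additive : p.Additive
  l_additive : l.Additive
  e_additive : e.Additive
  r_additive : r.Additive
  adj_q_i : q ⊣ i
  adj_i_p : i ⊣ p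
  adj_l_e : l ⊣ e
  adj_e_r : e ⊣ r
  i_full : i.Full
  i_faithful : i.Faithful
  l_full : l.Full
  l_faithful : l.Faithful
  r_full : r.Full
  r_faithful : r.Faithful
  essImage_i_eq_kernel_e : i.essImage = e.kernel

/-- A recollement of triangulated categories `(U, T, V)`: all six functors are triangle functors,
and the four adjunctions are adjunctions of triangle functors. -/
structure TriangulatedRecollement
    (U : Type u₁) (T : Type u₂) (V : Type u₃)
    [Category.{v₁} U] [Category.{v₂} T] [Category.{v₃} V]
    [HasShift U ℤ] [HasShift T ℤ] [HasShift V ℤ]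
    [Preadditive U] [Preadditive T] [Preadditive V]
    [HasZeroObject U] [HasZeroObject T] [HasZeroObject V]
    [∀ n : ℤ, (shiftFunctor U n).Additive] [∀ n : ℤ, (shiftFunctor T n).Additive]
    [∀ n : ℤ, (shiftFunctor V n).Additive]
    [Pretriangulated U] [Pretriangulated T] [Pretriangulated V] where
  q : T ⥤ U
  i : U ⥤ T
  p : T ⥤ U
  l : V ⥤ T
  e : T ⥤ V
  r : V ⥤ T
  [q_commShift : q.CommShift ℤ]
  [i_commShift : i.CommShift ℤ]
  [p_commShift : p.CommShift ℤ]
  [l_commShift : l.CommShift ℤ]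
  [e_commShift : e.CommShift ℤ]
  [r_commShift : r.CommShift ℤ]
  adj_q_i : q ⊣ i
  adj_i_p : i ⊣ p
  adj_l_e : l ⊣ e
  adj_e_r : e ⊣ r
  adj_q_i_isTriangulated : adj_q_i.IsTriangulated
  adj_i_p_isTriangulated : adj_i_p.IsTriangulated
  adj_l_e_isTriangulated : adj_l_e.IsTriangulated
  adj_e_r_isTriangulated : adj_e_r.IsTriangulated
  i_full : i.Full
  i_faithful : i.Faithful
  l_full : l.Full
  l_faithful : l.Faithful
  r_full : r.Full
  r_faithful : r.Faithful
  essImage_i_eq_kernel_e : i.essImage = e.kernel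

attribute [instance] TriangulatedRecollement.q_commShift TriangulatedRecollement.i_commShift
  TriangulatedRecollement.p_commShift TriangulatedRecollement.l_commShift
  TriangulatedRecollement.e_commShift TriangulatedRecollement.r_commShift

/-- Two functors between categories with shift are isomorphic through an isomorphism which is
compatible with the shifts. -/
def ShiftIso {X : Type u₁} {Y : Type u₂} [Category.{v₁} X] [Category.{v₂} Y]
    [HasShift X ℤ] [HasShift Y ℤ] (F G : X ⥤ Y) [F.CommShift ℤ] [G.CommShift ℤ] : Prop :=
  ∃ φ : F ≅ G, NatTrans.CommShift φ.hom ℤ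

/-- A recollement of triangulated categories `(U, T, V)` restricts to the full triangulated
subcategories given by `PU`, `PT` and `PV`: there is a recollement of these subcategories whose
six functors are the restrictions of the given six functors. -/
def TriangulatedRecollement.RestrictsTo
    {U : Type u₁} {T : Type u₂} {V : Type u₃}
    [Category.{v₁} U] [Category.{v₂} T] [Category.{v₃} V]
    [HasShift U ℤ] [HasShift T ℤ] [HasShift V ℤ]
    [Preadditive U] [Preadditive T] [Preadditive V]
    [HasZeroObject U] [HasZeroObject T] [HasZeroObject V]
    [∀ n : ℤ, (shiftFunctor U n).Additive] [∀ n : ℤ, (shiftFunctor T n).Additive]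
    [∀ n : ℤ, (shiftFunctor V n).Additive]
    [Pretriangulated U] [Pretriangulated T] [Pretriangulated V]
    (R : TriangulatedRecollement U T V)
    (PU : ObjectProperty U) (PT : ObjectProperty T) (PV : ObjectProperty V)
    [PU.IsTriangulated] [PT.IsTriangulated] [PV.IsTriangulated] : Prop :=
  ∃ S : TriangulatedRecollement PU.FullSubcategory PT.FullSubcategory PV.FullSubcategory,
    ShiftIso (S.q ⋙ PU.ι) (PT.ι ⋙ R.q) ∧
    ShiftIso (S.i ⋙ PT.ι) (PU.ι ⋙ R.i) ∧
    ShiftIso (S.p ⋙ PU.ι) (PT.ι ⋙ R.p) ∧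
    ShiftIso (S.l ⋙ PT.ι) (PV.ι ⋙ R.l) ∧
    ShiftIso (S.e ⋙ PV.ι) (PT.ι ⋙ R.e) ∧
    ShiftIso (S.r ⋙ PT.ι) (PV.ι ⋙ R.r)

/-- A torsion pair in an abelian category. -/
structure IsTorsionPair {B : Type u₂} [Category.{v₂} B] [Abelian B]
    (X Y : ObjectProperty B) : Prop where
  hom_eq_zero : ∀ ⦃M N : B⦄ (f : M ⟶ N), X M → Y N → f = 0
  exists_shortExact : ∀ M : B, ∃ (M' M'' : B) (f : M' ⟶ M) (g : M ⟶ M'') (w : f ≫ g = 0),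
    X M' ∧ Y M'' ∧ (ShortComplex.mk f g w).ShortExact

section Ladders

variable {A : Type u₁} {B : Type u₂} {C : Type u₃}
  [Category.{v₁} A] [Category.{v₂} B] [Category.{v₃} C] [Abelian A] [Abelian B] [Abelian C]

/-- The sequence `F, G 0, G 1, G 2, …`. -/
def prepend (F : C ⥤ B) (G : ℕ → (C ⥤ B)) : ℕ → (C ⥤ B)
  | 0 => F
  | k + 1 => G k

/-- A ladder of `l`-height `n` of a recollement: consecutive left adjoints
`lⁿ⁻¹ ⊣ ⋯ ⊣ l² ⊣ l¹ ⊣ l⁰ = R.l`, with `odd k = l²ᵏ⁺¹ : B ⥤ C` and `even k = l²ᵏ : C ⥤ B`.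
Nothing is required of the functors `lʲ` with `n ≤ j`. -/
structure LeftLadder (R : AbelianRecollement A B C) (n : ℕ) where
  odd : ℕ → (B ⥤ C)
  evenSucc : ℕ → (C ⥤ B)
  odd_additive : ∀ k, 2 * k + 1 < n → (odd k).Additive
  evenSucc_additive : ∀ k, 2 * k + 2 < n → (evenSucc k).Additive
  adj_odd : ∀ k, 2 * k + 1 < n → (odd k ⊣ prepend R.l evenSucc k)
  adj_even : ∀ k, 2 * k + 2 < n → (evenSucc k ⊣ odd k)

/-- The functor `l²ᵏ : C ⥤ B` of a ladder. -/
def LeftLadder.even {R : AbelianRecollement A B C} {n : ℕ} (L : LeftLadder R n) : ℕ → (C ⥤ B) :=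
  prepend R.l L.evenSucc

/-- A ladder of `r`-height `n` of a recollement: consecutive right adjoints
`R.r = r⁰ ⊣ r¹ ⊣ r² ⊣ ⋯ ⊣ rⁿ⁻¹`, with `odd k = r²ᵏ⁺¹ : B ⥤ C` and `even k = r²ᵏ : C ⥤ B`.
Nothing is required of the functors `rʲ` with `n ≤ j`. -/
structure RightLadder (R : AbelianRecollement A B C) (n : ℕ) where
  odd : ℕ → (B ⥤ C)
  evenSucc : ℕ → (C ⥤ B)
  odd_additive : ∀ k, 2 * k + 1 < n → (odd k).Additive
  evenSucc_additive : ∀ k, 2 * k + 2 < n → (evenSucc k).Additive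
  adj_odd : ∀ k, 2 * k + 1 < n → (prepend R.r evenSucc k ⊣ odd k)
  adj_even : ∀ k, 2 * k + 2 < n → (odd k ⊣ evenSucc k)

/-- The functor `r²ᵏ : C ⥤ B` of a ladder. -/
def RightLadder.even {R : AbelianRecollement A B C} {n : ℕ} (L : RightLadder R n) :
    ℕ → (C ⥤ B) :=
  prepend R.r L.evenSucc

theorem AbelianRecollement.isExactFunctor_e (R : AbelianRecollement A B C) :
    IsExactFunctor R.e where
  additive := R.e_additive
  preservesFiniteLimits := by
    have := R.adj_l_e.rightAdjoint_preservesLimits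
    infer_instance
  preservesFiniteColimits := by
    have := R.adj_e_r.leftAdjoint_preservesColimits
    infer_instance

instance (e : B ⥤ C) [IsExactFunctor e] : e.kernel.IsSerreClass :=
  inferInstanceAs ((ObjectProperty.inverseImage IsZero e).IsSerreClass)

instance (e : B ⥤ C) [IsExactFunctor e] : e.kernel.IsClosedUnderFiniteProducts where
  isClosedUnderLimitsOfShape J _ := ⟨by
    rintro X ⟨p⟩
    refine (IsZero.iff_id_eq_zero _).2 ((isLimitOfPreserves e p.isLimit).hom_ext fun j ↦ ?_)
    exact (p.prop_diag_obj j : IsZero (e.obj (p.diag.obj j))).eq_of_tgt _ _⟩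

/-- There is a recollement of abelian categories `(Ker e, B, C)`, with the full subcategory
`Ker e` of `B` and its inclusion functor, given by the adjoint triple `(l, e, r)`.
(Exactness of `e` is what makes `Ker e` an abelian category.) -/
def HasKernelRecollement (l : C ⥤ B) (e : B ⥤ C) (r : C ⥤ B) : Prop :=
  ∃ (_ : IsExactFunctor e) (S : AbelianRecollement e.kernel.FullSubcategory B C),
    S.i = e.kernel.ι ∧ S.l = l ∧ S.e = e ∧ S.r = r

end Ladders

section Derived

variable {A : Type u₁} {B : Type u₂} {C : Type u₃}
  [Category.{v₁} A] [Category.{v₂} B] [Category.{v₃} C] [Abelian A] [Abelian B] [Abelian C]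
  [HasDerivedCategory.{w₂} B] [HasDerivedCategory.{w₃} C]

/-- The objects of `D(B)` whose cohomology objects all lie in the essential image of
`i : A ⥤ B`: the full subcategory they form is `D_A(B)`. -/
def cohomologyIn (R : AbelianRecollement A B C) : ObjectProperty (DerivedCategory B) :=
  fun X ↦ ∀ n : ℤ, R.i.essImage ((DerivedCategory.homologyFunctor B n).obj X)

instance (R : AbelianRecollement A B C) : (cohomologyIn R).IsClosedUnderIsomorphisms where
  of_iso e hX n := R.i.essImage.prop_of_iso
    ((DerivedCategory.homologyFunctor B n).mapIso e) (hX n)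

instance (R : AbelianRecollement A B C) : (cohomologyIn R).IsTriangulated where
  exists_zero := ⟨_, isZero_zero (DerivedCategory B), fun n ↦ by
    rw [R.essImage_i_eq_kernel_e]
    have := R.isExactFunctor_e
    exact R.e.map_isZero ((DerivedCategory.homologyFunctor B n).map_isZero (isZero_zero _))⟩
  isStableUnderShiftBy a := ⟨fun X hX n ↦ R.i.essImage.prop_of_iso
    (((DerivedCategory.homologyFunctor B 0).shiftIso a n (a + n) rfl).symm.app X) (hX (a + n))⟩
  toIsTriangulatedClosed₂ := .mk' (fun T hT h₁ h₃ n ↦ by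
    have := R.isExactFunctor_e
    have h₁' := h₁ n
    have h₃' := h₃ n
    rw [R.essImage_i_eq_kernel_e] at h₁' h₃' ⊢
    exact ((DerivedCategory.HomologySequence.exact₂ T hT n).map R.e).isZero_of_both_zeros
      (h₁'.eq_of_src _ _) (h₃'.eq_of_tgt _ _))

/-- The bounded derived category `Dᵇ(B)`, as a full subcategory of `D(B)`. -/
abbrev boundedObjects (B : Type u₂) [Category.{v₂} B] [Abelian B] [HasDerivedCategory.{w₂} B] :
    ObjectProperty (DerivedCategory B) :=
  (DerivedCategory.TStructure.t (C := B)).bounded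

/-- `Dᵇ_A(B)`, as a full subcategory of `D_A(B)`. -/
abbrev boundedCohomologyIn (R : AbelianRecollement A B C) :
    ObjectProperty (cohomologyIn R).FullSubcategory :=
  (boundedObjects B).inverseImage (cohomologyIn R).ι

/-- The functors `q : B ⥤ C`, `i : C ⥤ B`, `p : B ⥤ C` are exact, and the functors which they
induce between `D(B)` and `D(C)` are the left half of a recollement of triangulated categories
`(D(C), D(B), D_A(B))` which restricts to the bounded derived categories, i.e. to a recollement
`(Dᵇ(C), Dᵇ(B), Dᵇ_A(B))`. -/
def InducesDerivedRecollement (R : AbelianRecollement A B C)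
    (q : B ⥤ C) (i : C ⥤ B) (p : B ⥤ C) : Prop :=
  ∃ (_ : IsExactFunctor q) (_ : IsExactFunctor i) (_ : IsExactFunctor p)
    (S : TriangulatedRecollement (DerivedCategory C) (DerivedCategory B)
      (cohomologyIn R).FullSubcategory),
    ShiftIso S.q q.mapDerivedCategory ∧
    ShiftIso S.i i.mapDerivedCategory ∧
    ShiftIso S.p p.mapDerivedCategory ∧
    S.RestrictsTo (boundedObjects C) (boundedObjects B) (boundedCohomologyIn R)

end Derived

end RecollementLadder

/-!
Parts (i) and (iii) are about torsion pairs. Since `l¹ ⊣ l⁰`, the kernel of `l¹` is the left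
orthogonal of the essential image of `l⁰` (`leftOrthogonal_essImage`), and in a well-powered
cocomplete abelian category every left orthogonal is a torsion class
(`isTorsionPair_leftOrthogonal`): the torsion part of an object is the sum of its torsion
subobjects.
Part (iii) is dual.

For the abelian recollements in (ii) and (iv), take an adjoint triple `(l, e, r)` with `l`, and
hence `r`, fully faithful. Then `e` is exact, and the cokernel of the counit `l (e X) ⟶ X` and the
kernel of the unit `X ⟶ r (e X)` are the reflection and the coreflection of `X` onto the kernel of
`e` (`hasKernelRecollement`).

For the derived recollements, a functor with adjoints on both sides is exact, so the three functors
of the triple induce triangulated functors between the unbounded derived categories, without any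
derived functors. They are again adjoint as triangulated functors (`mapDerivedCategoryAdjunction`),
and the middle one stays fully faithful (`fullyFaithfulMapDerivedCategory`). An adjoint triple
`q ⊣ i ⊣ p` of triangulated functors with `i` fully faithful is one half of a recollement
whose third term may be taken to be the kernel of `p` (`rightKernelRecollement`) or the kernel of
`q` (`leftKernelRecollement`). The functors of the other half are given on objects by the cone of
`i (p X) ⟶ X`, the fiber of `X ⟶ i (q X)`, and the inclusion of the kernel. In the situation
at hand `p`, respectively `q`, is induced by the exact functor `e`, and its kernel is `D_A(B)`
(`cohomologyIn_eq_kernel`). Exact functors preserve bounded objects, and hence so do these cones and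
fibers, whence the restriction to bounded derived categories
(`TriangulatedRecollement.restrictsTo`).
-/

namespace RecollementLadder

/-! ### Natural transformations commuting with shifts -/

section CommShift

variable {C D E M : Type*} [Category* C] [Category* D] [Category* E] [AddMonoid M]
  [HasShift C M] [HasShift D M] [HasShift E M]

/-- Compatibility with shifts may be tested after precomposition with an essentially surjective
functor, e.g. a localization functor. -/
theorem natTransCommShift_of_whiskerLeft (L : C ⥤ D) [L.CommShift M] [L.EssSurj]
    {F G : D ⥤ E} [F.CommShift M] [G.CommShift M] (τ : F ⟶ G)
    [NatTrans.CommShift (Functor.whiskerLeft L τ) M] : NatTrans.CommShift τ M where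
  shift_comm a := by
    ext Y
    have h := NatTrans.shift_app_comm (Functor.whiskerLeft L τ) a (L.objPreimage Y)
    simp only [Functor.commShiftIso_comp_hom_app, Functor.whiskerLeft_app, Category.assoc,
      Functor.comp_obj] at h
    rw [← NatTrans.naturality_assoc, cancel_epi] at h
    let e := L.objObjPreimageIso Y
    have h₁ := (F.commShiftIso a).hom.naturality e.hom
    have h₂ := (G.commShiftIso a).hom.naturality e.hom
    simp only [Functor.comp_obj, Functor.comp_map] at h₁ h₂
    simp only [NatTrans.comp_app, Functor.whiskerRight_app, Functor.whiskerLeft_app]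
    rw [← cancel_epi (F.map (e.hom⟦a⟧')), reassoc_of% h₁, NatTrans.naturality_assoc, h₂,
      ← reassoc_of% h, ← Functor.map_comp, ← Functor.map_comp, NatTrans.naturality]

/-- Compatibility with shifts may be tested after postcomposition with a faithful functor, e.g. the
inclusion of a full subcategory. -/
theorem natTransCommShift_of_whiskerRight {F G : C ⥤ D} [F.CommShift M] [G.CommShift M]
    (τ : F ⟶ G) (H : D ⥤ E) [H.CommShift M] [H.Faithful]
    [NatTrans.CommShift (Functor.whiskerRight τ H) M] : NatTrans.CommShift τ M where
  shift_comm a := by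
    ext X
    have h := NatTrans.shift_app_comm (Functor.whiskerRight τ H) a X
    simp only [Functor.commShiftIso_comp_hom_app, Functor.whiskerRight_app, Category.assoc,
      Functor.comp_obj] at h
    have h' := (H.commShiftIso a).hom.naturality (τ.app X)
    simp only [Functor.comp_obj, Functor.comp_map] at h'
    rw [← h', ← Functor.map_comp_assoc, ← Functor.map_comp_assoc, cancel_mono] at h
    exact H.map_injective h

end CommShift

/-! ### Adjunctions between categories of complexes -/

section MapHomologicalComplex

variable {C D ι : Type*} [Category* C] [Category* D] [Preadditive C] [Preadditive D]
  {F : C ⥤ D} {G : D ⥤ C} [F.Additive] [G.Additive]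

/-- The adjunction between categories of homological complexes obtained by applying an adjunction
degreewise. -/
@[simps!]
def mapHomologicalComplexAdjunction (adj : F ⊣ G) (c : ComplexShape ι) :
    F.mapHomologicalComplex c ⊣ G.mapHomologicalComplex c where
  unit :=
    { app := fun K ↦
        { f := fun i ↦ adj.unit.app (K.X i)
          comm' := fun i j _ ↦ (adj.unit.naturality (K.d i j)).symm }
      naturality := fun K L f ↦ by ext i; exact adj.unit.naturality (f.f i) }
  counit :=
    { app := fun K ↦
        { f := fun i ↦ adj.counit.app (K.X i)
          comm' := fun i j _ ↦ (adj.counit.naturality (K.d i j)).symm }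
      naturality := fun K L f ↦ by ext i; exact adj.counit.naturality (f.f i) }
  left_triangle_components K := by
    ext i
    exact adj.left_triangle_components (K.X i)
  right_triangle_components K := by
    ext i
    exact adj.right_triangle_components (K.X i)

instance (adj : F ⊣ G) :
    (mapHomologicalComplexAdjunction adj (ComplexShape.up ℤ)).CommShift ℤ :=
  Adjunction.CommShift.mk' _ _ ⟨fun a ↦ by
    -- The shift isomorphisms of the functors between categories of complexes are identities in each
    -- degree.
    ext K i
    simp only [NatTrans.comp_app, Functor.whiskerRight_app, Functor.whiskerLeft_app,
      Functor.commShiftIso_comp_hom_app, Functor.commShiftIso_id_hom_app, Functor.id_obj,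
      HomologicalComplex.comp_f]
    change 𝟙 (K.X (i + a)) ≫ adj.unit.app (K.X (i + a)) =
      adj.unit.app (K.X (i + a)) ≫ G.map (𝟙 (F.obj (K.X (i + a)))) ≫ 𝟙 _
    rw [G.map_id, Category.id_comp, Category.comp_id]
    exact (Category.comp_id _).symm⟩

end MapHomologicalComplex

/-! ### Exact functors and derived categories -/

section DerivedCategory

variable {C : Type u₁} {D : Type u₂} [Category.{v₁} C] [Category.{v₂} D] [Abelian C] [Abelian D]
  [HasDerivedCategory.{w₂} C] [HasDerivedCategory.{w₃} D]

section

variable {F : C ⥤ D} {G : D ⥤ C} [F.Additive] [G.Additive]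
  [PreservesFiniteLimits F] [PreservesFiniteColimits F]
  [PreservesFiniteLimits G] [PreservesFiniteColimits G] (adj : F ⊣ G)

/-- The adjunction between derived categories induced by an adjunction of exact functors. -/
noncomputable def mapDerivedCategoryAdjunction : F.mapDerivedCategory ⊣ G.mapDerivedCategory :=
  letI : CatCommSq (F.mapHomologicalComplex (ComplexShape.up ℤ)) DerivedCategory.Q
    DerivedCategory.Q F.mapDerivedCategory := ⟨F.mapDerivedCategoryFactors.symm⟩
  letI : CatCommSq (G.mapHomologicalComplex (ComplexShape.up ℤ)) DerivedCategory.Q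
    DerivedCategory.Q G.mapDerivedCategory := ⟨G.mapDerivedCategoryFactors.symm⟩
  (mapHomologicalComplexAdjunction adj (ComplexShape.up ℤ)).localization
    DerivedCategory.Q (HomologicalComplex.quasiIso C (ComplexShape.up ℤ))
    DerivedCategory.Q (HomologicalComplex.quasiIso D (ComplexShape.up ℤ)) _ _

theorem mapDerivedCategoryAdjunction_unit_app (K : CochainComplex C ℤ) :
    (mapDerivedCategoryAdjunction adj).unit.app (DerivedCategory.Q.obj K) =
      DerivedCategory.Q.map
        ((mapHomologicalComplexAdjunction adj (ComplexShape.up ℤ)).unit.app K) ≫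
      G.mapDerivedCategoryFactors.inv.app _ ≫
      G.mapDerivedCategory.map (F.mapDerivedCategoryFactors.inv.app K) :=
  letI : CatCommSq (F.mapHomologicalComplex (ComplexShape.up ℤ)) DerivedCategory.Q
    DerivedCategory.Q F.mapDerivedCategory := ⟨F.mapDerivedCategoryFactors.symm⟩
  letI : CatCommSq (G.mapHomologicalComplex (ComplexShape.up ℤ)) DerivedCategory.Q
    DerivedCategory.Q G.mapDerivedCategory := ⟨G.mapDerivedCategoryFactors.symm⟩
  Adjunction.localization_unit_app _ DerivedCategory.Q
    (HomologicalComplex.quasiIso C (ComplexShape.up ℤ))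
    DerivedCategory.Q (HomologicalComplex.quasiIso D (ComplexShape.up ℤ)) _ _ K

instance : (mapDerivedCategoryAdjunction adj).CommShift ℤ := by
  -- Restricted to complexes, the unit is a composition of morphisms compatible with the shifts.
  have h : Functor.whiskerLeft DerivedCategory.Q (mapDerivedCategoryAdjunction adj).unit =
      (Functor.rightUnitor _).hom ≫ (Functor.leftUnitor _).inv ≫ Functor.whiskerRight
        (mapHomologicalComplexAdjunction adj (ComplexShape.up ℤ)).unit DerivedCategory.Q ≫
      (Functor.associator _ _ _).hom ≫
      Functor.whiskerLeft _ G.mapDerivedCategoryFactors.inv ≫ (Functor.associator _ _ _).inv ≫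
      Functor.whiskerRight F.mapDerivedCategoryFactors.inv G.mapDerivedCategory ≫
      (Functor.associator _ _ _).hom := by
    ext K
    simp [mapDerivedCategoryAdjunction_unit_app]
  have : NatTrans.CommShift
      (Functor.whiskerLeft DerivedCategory.Q (mapDerivedCategoryAdjunction adj).unit) ℤ := by
    rw [h]
    infer_instance
  exact Adjunction.CommShift.mk' _ _
    (natTransCommShift_of_whiskerLeft DerivedCategory.Q (mapDerivedCategoryAdjunction adj).unit)

instance : (mapDerivedCategoryAdjunction adj).IsTriangulated where

/-- On the image of a complex the counit is induced by the degreewise counit, an isomorphism when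
`G` is fully faithful. -/
theorem isIso_mapDerivedCategoryAdjunction_counit [G.Full] [G.Faithful] :
    IsIso (mapDerivedCategoryAdjunction adj).counit := by
  have (K : CochainComplex D ℤ) : IsIso ((mapDerivedCategoryAdjunction adj).counit.app
      (DerivedCategory.Q.obj K)) := by
    let : CatCommSq (F.mapHomologicalComplex (ComplexShape.up ℤ)) DerivedCategory.Q
      DerivedCategory.Q F.mapDerivedCategory := ⟨F.mapDerivedCategoryFactors.symm⟩
    let : CatCommSq (G.mapHomologicalComplex (ComplexShape.up ℤ)) DerivedCategory.Q
      DerivedCategory.Q G.mapDerivedCategory := ⟨G.mapDerivedCategoryFactors.symm⟩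
    rw [mapDerivedCategoryAdjunction, Adjunction.localization_counit_app]
    have (i : ℤ) : IsIso
        (((mapHomologicalComplexAdjunction adj (ComplexShape.up ℤ)).counit.app K).f i) :=
      inferInstanceAs (IsIso (adj.counit.app (K.X i)))
    have := HomologicalComplex.Hom.isIso_of_components
      ((mapHomologicalComplexAdjunction adj (ComplexShape.up ℤ)).counit.app K)
    infer_instance
  have (X : DerivedCategory D) : IsIso ((mapDerivedCategoryAdjunction adj).counit.app X) := by
    rw [← NatTrans.isIso_app_iff_of_iso _ (DerivedCategory.Q.objObjPreimageIso X)]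
    infer_instance
  exact NatIso.isIso_of_isIso_app _

/-- An exact fully faithful functor with an exact left adjoint induces a fully faithful functor
between the derived categories. -/
noncomputable def fullyFaithfulMapDerivedCategory [G.Full] [G.Faithful] :
    (G.mapDerivedCategory : DerivedCategory D ⥤ DerivedCategory C).FullyFaithful :=
  have := isIso_mapDerivedCategoryAdjunction_counit adj
  (mapDerivedCategoryAdjunction adj).fullyFaithfulROfIsIsoCounit

end

section

variable (F : C ⥤ D) [F.Additive] [PreservesFiniteLimits F] [PreservesFiniteColimits F]

/-- The functor induced by an exact functor commutes with the cohomology functors. -/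
theorem nonempty_homologyFunctor_mapDerivedCategory_iso (X : DerivedCategory C) (n : ℤ) :
    Nonempty ((DerivedCategory.homologyFunctor D n).obj (F.mapDerivedCategory.obj X) ≅
      F.obj ((DerivedCategory.homologyFunctor C n).obj X)) := by
  obtain ⟨K, ⟨e⟩⟩ : ∃ K : CochainComplex C ℤ, Nonempty (DerivedCategory.Q.obj K ≅ X) :=
    ⟨_, ⟨DerivedCategory.Q.objObjPreimageIso X⟩⟩
  exact ⟨(DerivedCategory.homologyFunctor D n).mapIso (F.mapDerivedCategory.mapIso e.symm ≪≫
      F.mapDerivedCategoryFactors.app K) ≪≫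
    (DerivedCategory.homologyFunctorFactors D n).app _ ≪≫ (K.sc n).mapHomologyIso F ≪≫
    F.mapIso ((DerivedCategory.homologyFunctorFactors C n).symm.app K ≪≫
      (DerivedCategory.homologyFunctor C n).mapIso e)⟩

theorem boundedObjects_mapDerivedCategory (X : DerivedCategory C) (hX : boundedObjects C X) :
    boundedObjects D (F.mapDerivedCategory.obj X) := by
  obtain ⟨⟨a, ha⟩, ⟨b, hb⟩⟩ := hX
  refine ⟨⟨a, ?_⟩, ⟨b, ?_⟩⟩
  · refine (DerivedCategory.isGE_iff _ _).2 fun i hi ↦ ?_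
    obtain ⟨e⟩ := nonempty_homologyFunctor_mapDerivedCategory_iso F X i
    exact (F.map_isZero ((DerivedCategory.isGE_iff _ _).1 ha i hi)).of_iso e
  · refine (DerivedCategory.isLE_iff _ _).2 fun i hi ↦ ?_
    obtain ⟨e⟩ := nonempty_homologyFunctor_mapDerivedCategory_iso F X i
    exact (F.map_isZero ((DerivedCategory.isLE_iff _ _).1 hb i hi)).of_iso e

theorem isZero_iff_isZero_homology (X : DerivedCategory C) :
    IsZero X ↔ ∀ n, IsZero ((DerivedCategory.homologyFunctor C n).obj X) := by
  refine ⟨fun h n ↦ Functor.map_isZero _ h, fun h ↦ ?_⟩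
  have hZ := isZero_zero (DerivedCategory C)
  have : IsIso (hZ.from_ X) := (DerivedCategory.isIso_iff _ _).2 fun n ↦
    isIso_of_source_target_iso_zero _ (h n).isoZero (Functor.map_isZero _ hZ).isoZero
  exact hZ.of_iso (asIso (hZ.from_ X))

end

end DerivedCategory

/-- `D_A(B)` is the kernel of the functor induced by `e`, since `e` is exact and the essential image
of `i` is the kernel of `e`. -/
theorem cohomologyIn_eq_kernel {A : Type u₁} {B : Type u₂} {C : Type u₃}
    [Category.{v₁} A] [Category.{v₂} B] [Category.{v₃} C] [Abelian A] [Abelian B] [Abelian C]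
    [HasDerivedCategory.{w₂} B] [HasDerivedCategory.{w₃} C]
    (R : AbelianRecollement A B C) [R.e.Additive] [PreservesFiniteLimits R.e]
    [PreservesFiniteColimits R.e] :
    cohomologyIn R =
      (R.e.mapDerivedCategory : DerivedCategory B ⥤ DerivedCategory C).kernel := by
  ext X
  refine Iff.trans ?_ (isZero_iff_isZero_homology _).symm
  refine forall_congr' fun n ↦ ?_
  obtain ⟨e⟩ := nonempty_homologyFunctor_mapDerivedCategory_iso R.e X n
  rw [R.essImage_i_eq_kernel_e]
  exact e.isZero_iff.symm

/-! ### Orthogonals of the essential image of a functor with adjoints -/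

section Orthogonal

variable {U : Type u₁} {T : Type u₂} [Category.{v₁} U] [Category.{v₂} T] [Preadditive U]
  [Preadditive T]

/-- The objects right orthogonal to the image of `i` form the kernel of the right adjoint of `i`, as
`Hom(i X, Y) = Hom(X, p Y)`. -/
theorem rightOrthogonal_essImage {i : U ⥤ T} {p : T ⥤ U} (adj : i ⊣ p) :
    i.essImage.rightOrthogonal = p.kernel := by
  have := adj.isLeftAdjoint
  ext Y
  refine ⟨fun h ↦ (IsZero.iff_id_eq_zero _).2 ?_, ?_⟩
  · apply (adj.homEquiv _ _).symm.injective
    exact (h _ (i.obj_mem_essImage _)).trans (h _ (i.obj_mem_essImage _)).symm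
  · rintro h X f ⟨V, ⟨e⟩⟩
    rw [← cancel_epi e.hom, comp_zero]
    apply (adj.homEquiv _ _).injective
    exact IsZero.eq_of_tgt h _ _

/-- The objects left orthogonal to the image of `i` form the kernel of the left adjoint of `i`, as
`Hom(X, i Y) = Hom(q X, Y)`. -/
theorem leftOrthogonal_essImage {q : T ⥤ U} {i : U ⥤ T} (adj : q ⊣ i) :
    i.essImage.leftOrthogonal = q.kernel := by
  have := adj.isRightAdjoint
  ext Y
  refine ⟨fun h ↦ (IsZero.iff_id_eq_zero _).2 ?_, ?_⟩
  · apply (adj.homEquiv _ _).injective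
    exact (h _ (i.obj_mem_essImage _)).trans (h _ (i.obj_mem_essImage _)).symm
  · rintro h X f ⟨V, ⟨e⟩⟩
    rw [← cancel_mono e.inv, zero_comp]
    apply (adj.homEquiv _ _).symm.injective
    exact IsZero.eq_of_src h _ _

theorem rightOrthogonal_essImage_of_eq_kernel {i : U ⥤ T} {p : T ⥤ U} (adj : i ⊣ p)
    {P : ObjectProperty T} (hP : P = p.kernel) {Y : T} (hY : P Y) :
    i.essImage.rightOrthogonal Y := by
  rwa [rightOrthogonal_essImage adj, ← hP]

theorem leftOrthogonal_essImage_of_eq_kernel {q : T ⥤ U} {i : U ⥤ T} (adj : q ⊣ i)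
    {P : ObjectProperty T} (hP : P = q.kernel) {X : T} (hX : P X) :
    i.essImage.leftOrthogonal X := by
  rwa [leftOrthogonal_essImage adj, ← hP]

end Orthogonal

/-! ### Adjoint triples of triangulated functors and their kernels -/

section Triangulated

variable {U : Type u₁} {T : Type u₂} [Category.{v₁} U] [Category.{v₂} T]
  [HasShift T ℤ] [Preadditive T] [HasZeroObject T] [∀ n : ℤ, (shiftFunctor T n).Additive]
  [Pretriangulated T]
  {q : T ⥤ U} {i : U ⥤ T} {p : T ⥤ U}

section Cone

variable (adj : i ⊣ p)

/-- The cone of the counit `i (p X) ⟶ X`. -/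
noncomputable def counitCone (X : T) : T :=
  (distinguished_cocone_triangle (adj.counit.app X)).choose

/-- The morphism from `X` to the cone of `i (p X) ⟶ X`. -/
noncomputable def toCounitCone (X : T) : X ⟶ counitCone adj X :=
  (distinguished_cocone_triangle (adj.counit.app X)).choose_spec.choose

/-- The connecting morphism of the triangle on `i (p X) ⟶ X`. -/
noncomputable def counitConeδ (X : T) :
    counitCone adj X ⟶ (shiftFunctor T (1 : ℤ)).obj (i.obj (p.obj X)) :=
  (distinguished_cocone_triangle (adj.counit.app X)).choose_spec.choose_spec.choose

theorem counitCone_distinguished (X : T) :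
    Triangle.mk (adj.counit.app X) (toCounitCone adj X) (counitConeδ adj X) ∈ distTriang T :=
  (distinguished_cocone_triangle (adj.counit.app X)).choose_spec.choose_spec.choose_spec

theorem prop_counitCone (Q : ObjectProperty T) [Q.IsTriangulated] [Q.IsClosedUnderIsomorphisms]
    {X : T} (h : Q (i.obj (p.obj X))) (hX : Q X) : Q (counitCone adj X) :=
  Q.ext_of_isTriangulatedClosed₃ _ (counitCone_distinguished adj X) h hX

end Cone

section Fiber

variable (adj : q ⊣ i)

/-- The fiber of the unit `X ⟶ i (q X)`. -/
noncomputable def unitFiber (X : T) : T :=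
  (distinguished_cocone_triangle₁ (adj.unit.app X)).choose

/-- The morphism from the fiber of `X ⟶ i (q X)` to `X`. -/
noncomputable def fromUnitFiber (X : T) : unitFiber adj X ⟶ X :=
  (distinguished_cocone_triangle₁ (adj.unit.app X)).choose_spec.choose

/-- The connecting morphism of the triangle on `X ⟶ i (q X)`. -/
noncomputable def unitFiberδ (X : T) :
    i.obj (q.obj X) ⟶ (shiftFunctor T (1 : ℤ)).obj (unitFiber adj X) :=
  (distinguished_cocone_triangle₁ (adj.unit.app X)).choose_spec.choose_spec.choose

theorem unitFiber_distinguished (X : T) :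
    Triangle.mk (fromUnitFiber adj X) (adj.unit.app X) (unitFiberδ adj X) ∈ distTriang T :=
  (distinguished_cocone_triangle₁ (adj.unit.app X)).choose_spec.choose_spec.choose_spec

theorem prop_unitFiber (Q : ObjectProperty T) [Q.IsTriangulated] [Q.IsClosedUnderIsomorphisms]
    {X : T} (h : Q (i.obj (q.obj X))) (hX : Q X) : Q (unitFiber adj X) :=
  Q.ext_of_isTriangulatedClosed₁ _ (unitFiber_distinguished adj X) hX h

end Fiber

variable [HasShift U ℤ] [Preadditive U] [HasZeroObject U]
  [∀ n : ℤ, (shiftFunctor U n).Additive] [Pretriangulated U]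

/-- The counit becomes an isomorphism after applying `p`, so `p` kills its cone. -/
theorem kernel_counitCone [p.CommShift ℤ] [p.IsTriangulated] [i.Full] [i.Faithful]
    (adj : i ⊣ p) (X : T) :
    p.kernel (counitCone adj X) :=
  (Triangle.isZero₃_iff_isIso₁ _
    (p.map_distinguished _ (counitCone_distinguished adj X))).2
    (inferInstanceAs (IsIso (p.map (adj.counit.app X))))

theorem trW_toCounitCone [i.CommShift ℤ] [i.IsTriangulated] [i.Full] (adj : i ⊣ p) (X : T) :
    i.essImage.trW (toCounitCone adj X) :=
  ObjectProperty.trW.mk' _ (counitCone_distinguished adj X) (i.obj_mem_essImage _)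

/-- The unit becomes an isomorphism after applying `q`, so `q` kills its fiber. -/
theorem kernel_unitFiber [q.CommShift ℤ] [q.IsTriangulated] [i.Full] [i.Faithful]
    (adj : q ⊣ i) (X : T) :
    q.kernel (unitFiber adj X) :=
  (Triangle.isZero₁_iff_isIso₂ _
    (q.map_distinguished _ (unitFiber_distinguished adj X))).2
    (inferInstanceAs (IsIso (q.map (adj.unit.app X))))

theorem trW_fromUnitFiber [i.CommShift ℤ] [i.IsTriangulated] [i.Full] (adj : q ⊣ i) (X : T) :
    i.essImage.trW (fromUnitFiber adj X) :=
  ObjectProperty.trW.mk _ (unitFiber_distinguished adj X) (i.obj_mem_essImage _)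

section Bijective

variable {W : ObjectProperty T} [W.IsTriangulated]

/-- A morphism with cone in `W` induces bijections on maps to a right orthogonal object of `W`. -/
noncomputable def precompEquiv {X Y : T} (f : X ⟶ Y) (hf : W.trW f) {Z : T}
    (hZ : W.rightOrthogonal Z) : (Y ⟶ Z) ≃ (X ⟶ Z) :=
  Equiv.ofBijective (fun g ↦ f ≫ g) (by
    rw [← ObjectProperty.isLocal_trW] at hZ
    exact hZ f hf)

/-- A morphism with cone in `W` induces bijections on maps from a left orthogonal object of `W`. -/
noncomputable def postcompEquiv {X Y : T} (f : X ⟶ Y) (hf : W.trW f) {Z : T}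
    (hZ : W.leftOrthogonal Z) : (Z ⟶ X) ≃ (Z ⟶ Y) :=
  Equiv.ofBijective (fun g ↦ g ≫ f) (by
    rw [← ObjectProperty.isColocal_trW] at hZ
    exact hZ f hf)

end Bijective

section FullSubcategory

variable {C : Type*} [Category* C]

/-- Morphisms in a full subcategory are morphisms in the ambient category. -/
def fullSubcategoryHomEquiv {P : ObjectProperty C} (X Y : P.FullSubcategory) :
    (X ⟶ Y) ≃ (X.obj ⟶ Y.obj) where
  toFun f := f.hom
  invFun f := P.homMk f

theorem isZero_obj_iff [HasZeroMorphisms C] {P : ObjectProperty C} (X : P.FullSubcategory) :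
    IsZero X.obj ↔ IsZero X := by
  refine ⟨IsZero.of_full_of_faithful_of_isZero P.ι X, fun h ↦ (IsZero.iff_id_eq_zero _).2 ?_⟩
  exact congr_arg InducedCategory.Hom.hom (h.eq_of_src (𝟙 X) 0)

end FullSubcategory

section KernelRight

variable [i.CommShift ℤ] [p.CommShift ℤ] [i.Full] [i.Faithful]
  (adj₂ : i ⊣ p) [adj₂.IsTriangulated] (P : ObjectProperty T) (hP : P = p.kernel)

/-- The functor `X ↦ cone (i (p X) ⟶ X)`, with values in the kernel of `p`. -/
noncomputable def kernelReflection : T ⥤ P.FullSubcategory :=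
  Adjunction.leftAdjointOfEquiv (G := P.ι)
    (F_obj := fun X ↦ ⟨counitCone adj₂ X, hP ▸ kernel_counitCone adj₂ X⟩)
    (fun X Y ↦ (fullSubcategoryHomEquiv _ _).trans (precompEquiv _ (trW_toCounitCone adj₂ X)
      (rightOrthogonal_essImage_of_eq_kernel adj₂ hP Y.property)))
    (fun _ _ _ _ _ ↦ (Category.assoc _ _ _).symm)

/-- The kernel of `p` is a reflective subcategory. -/
noncomputable def kernelReflectionAdjunction : kernelReflection adj₂ P hP ⊣ P.ι :=
  Adjunction.adjunctionOfEquivLeft _ _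

theorem trW_kernelReflectionAdjunction_unit_app (X : T) :
    i.essImage.trW ((kernelReflectionAdjunction adj₂ P hP).unit.app X) := by
  have : (kernelReflectionAdjunction adj₂ P hP).unit.app X = toCounitCone adj₂ X :=
    Category.comp_id _
  rw [this]
  exact trW_toCounitCone adj₂ X

/-- The reflection kills `X` exactly when `i (p X) ⟶ X` is an isomorphism. -/
theorem essImage_eq_kernel_kernelReflection :
    i.essImage = (kernelReflection adj₂ P hP).kernel := by
  ext X
  rw [← adj₂.isIso_counit_app_iff_mem_essImage]
  exact (Triangle.isZero₃_iff_isIso₁ _ (counitCone_distinguished adj₂ X)).symm.trans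
    (isZero_obj_iff ((kernelReflection adj₂ P hP).obj X))

noncomputable instance [P.IsTriangulated] : (kernelReflection adj₂ P hP).CommShift ℤ :=
  (kernelReflectionAdjunction adj₂ P hP).leftAdjointCommShift ℤ

instance [P.IsTriangulated] : (kernelReflectionAdjunction adj₂ P hP).CommShift ℤ :=
  (kernelReflectionAdjunction adj₂ P hP).commShift_of_rightAdjoint ℤ

instance [P.IsTriangulated] : (kernelReflectionAdjunction adj₂ P hP).IsTriangulated :=
  Adjunction.IsTriangulated.mk'' _

variable [q.CommShift ℤ] (adj₁ : q ⊣ i) [adj₁.IsTriangulated]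

/-- For `Y` in the kernel of `p`, maps out of the fiber of `Y ⟶ i (q Y)` are maps from `Y` to
the reflection onto the kernel of `p`. -/
noncomputable def unitFiberHomEquiv (Y : P.FullSubcategory) (X : T) :
    (unitFiber adj₁ Y.obj ⟶ X) ≃ (Y ⟶ (kernelReflection adj₂ P hP).obj X) :=
  (postcompEquiv _ (trW_kernelReflectionAdjunction_unit_app adj₂ P hP X)
      (leftOrthogonal_essImage_of_eq_kernel adj₁ rfl (kernel_unitFiber adj₁ Y.obj))).trans
    ((precompEquiv _ (trW_fromUnitFiber adj₁ Y.obj)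
      (rightOrthogonal_essImage_of_eq_kernel adj₂ hP
        (((kernelReflection adj₂ P hP).obj X).property))).symm.trans
        (fullSubcategoryHomEquiv _ _).symm)

/-- The bijection `unitFiberHomEquiv` is characterized by the square formed with the fiber map of
`Y` and the reflection map of `X`. -/
theorem fromUnitFiber_unitFiberHomEquiv (Y : P.FullSubcategory) (X : T)
    (g : unitFiber adj₁ Y.obj ⟶ X) :
    fromUnitFiber adj₁ Y.obj ≫ (unitFiberHomEquiv adj₂ P hP adj₁ Y X g).hom =
      g ≫ (kernelReflectionAdjunction adj₂ P hP).unit.app X :=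
  (precompEquiv _ (trW_fromUnitFiber adj₁ Y.obj)
    (rightOrthogonal_essImage_of_eq_kernel adj₂ hP
      (((kernelReflection adj₂ P hP).obj X).property))).apply_symm_apply _

/-- The functor `Y ↦ fiber (Y ⟶ i (q Y))` on the kernel of `p`. -/
noncomputable def kernelReflectionLeftAdjoint : P.FullSubcategory ⥤ T :=
  Adjunction.leftAdjointOfEquiv (G := kernelReflection adj₂ P hP)
    (unitFiberHomEquiv adj₂ P hP adj₁)
    (fun Y X X' g h ↦ by
      ext
      apply (precompEquiv _ (trW_fromUnitFiber adj₁ Y.obj)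
        (rightOrthogonal_essImage_of_eq_kernel adj₂ hP
          (((kernelReflection adj₂ P hP).obj X').property))).injective
      have hnat := (kernelReflectionAdjunction adj₂ P hP).unit.naturality g
      calc
        _ = (h ≫ g) ≫ (kernelReflectionAdjunction adj₂ P hP).unit.app X' :=
          fromUnitFiber_unitFiberHomEquiv adj₂ P hP adj₁ Y X' (h ≫ g)
        _ = h ≫ (kernelReflectionAdjunction adj₂ P hP).unit.app X ≫
            ((kernelReflection adj₂ P hP).map g).hom :=
          (Category.assoc _ _ _).trans (congr_arg (h ≫ ·) hnat)
        _ = (fromUnitFiber adj₁ Y.obj ≫ (unitFiberHomEquiv adj₂ P hP adj₁ Y X h).hom) ≫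
            ((kernelReflection adj₂ P hP).map g).hom := by
          rw [fromUnitFiber_unitFiberHomEquiv]
          exact (Category.assoc _ _ _).symm
        _ = _ := Category.assoc _ _ _)

/-- The reflection onto the kernel of `p` has a left adjoint. -/
noncomputable def kernelReflectionLeftAdjunction :
    kernelReflectionLeftAdjoint adj₂ P hP adj₁ ⊣ kernelReflection adj₂ P hP :=
  Adjunction.adjunctionOfEquivLeft _ _

noncomputable instance [P.IsTriangulated] :
    (kernelReflectionLeftAdjoint adj₂ P hP adj₁).CommShift ℤ :=
  (kernelReflectionLeftAdjunction adj₂ P hP adj₁).leftAdjointCommShift ℤ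

instance [P.IsTriangulated] : (kernelReflectionLeftAdjunction adj₂ P hP adj₁).CommShift ℤ :=
  (kernelReflectionLeftAdjunction adj₂ P hP adj₁).commShift_of_rightAdjoint ℤ

instance [P.IsTriangulated] : (kernelReflectionLeftAdjunction adj₂ P hP adj₁).IsTriangulated :=
  Adjunction.IsTriangulated.mk'' _

/-- The recollement on an adjoint triple `q ⊣ i ⊣ p` of triangulated functors with `i` fully
faithful, whose third term is the kernel of `p`. -/
noncomputable def rightKernelRecollement [P.IsTriangulated] :
    TriangulatedRecollement U T P.FullSubcategory :=
  have ff := (Adjunction.Triple.mk (kernelReflectionLeftAdjunction adj₂ P hP adj₁)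
    (kernelReflectionAdjunction adj₂ P hP)).fullyFaithfulEquiv.symm P.fullyFaithfulι
  { q := q
    i := i
    p := p
    l := kernelReflectionLeftAdjoint adj₂ P hP adj₁
    e := kernelReflection adj₂ P hP
    r := P.ι
    adj_q_i := adj₁
    adj_i_p := adj₂
    adj_l_e := kernelReflectionLeftAdjunction adj₂ P hP adj₁
    adj_e_r := kernelReflectionAdjunction adj₂ P hP
    adj_q_i_isTriangulated := inferInstance
    adj_i_p_isTriangulated := inferInstance
    adj_l_e_isTriangulated := inferInstance
    adj_e_r_isTriangulated := inferInstance
    i_full := inferInstance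
    i_faithful := inferInstance
    l_full := ff.full
    l_faithful := ff.faithful
    r_full := inferInstance
    r_faithful := inferInstance
    essImage_i_eq_kernel_e := essImage_eq_kernel_kernelReflection adj₂ P hP }

end KernelRight

section KernelLeft

variable [q.CommShift ℤ] [i.CommShift ℤ] [i.Full] [i.Faithful]
  (adj₁ : q ⊣ i) [adj₁.IsTriangulated] (P : ObjectProperty T) (hP : P = q.kernel)

/-- Maps from an object `X` of the kernel of `q` to `Y` factor uniquely through the fiber of
`Y ⟶ i (q Y)`. -/
noncomputable def homUnitFiberEquiv (X : P.FullSubcategory) (Y : T) :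
    (X ⟶ (⟨unitFiber adj₁ Y, hP ▸ kernel_unitFiber adj₁ Y⟩ : P.FullSubcategory)) ≃
      (P.ι.obj X ⟶ Y) :=
  (fullSubcategoryHomEquiv _ _).trans (postcompEquiv _ (trW_fromUnitFiber adj₁ Y)
    (leftOrthogonal_essImage_of_eq_kernel adj₁ hP X.property))

/-- The functor `X ↦ fiber (X ⟶ i (q X))`, with values in the kernel of `q`. -/
noncomputable def kernelCoreflection : T ⥤ P.FullSubcategory :=
  Adjunction.rightAdjointOfEquiv (F := P.ι)
    (fun X Y ↦ (homUnitFiberEquiv adj₁ P hP X Y).symm)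
    (fun X' X Y f g ↦ by
      rw [Equiv.symm_apply_eq]
      refine Eq.trans ?_ (Category.assoc _ _ _).symm
      exact congr_arg (f.hom ≫ ·) ((homUnitFiberEquiv adj₁ P hP X Y).apply_symm_apply g).symm)

/-- The kernel of `q` is a coreflective subcategory. -/
noncomputable def kernelCoreflectionAdjunction : P.ι ⊣ kernelCoreflection adj₁ P hP :=
  Adjunction.adjunctionOfEquivRight _ _

theorem trW_kernelCoreflectionAdjunction_counit_app (X : T) :
    i.essImage.trW ((kernelCoreflectionAdjunction adj₁ P hP).counit.app X) := by
  have : (kernelCoreflectionAdjunction adj₁ P hP).counit.app X = fromUnitFiber adj₁ X :=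
    Category.id_comp _
  rw [this]
  exact trW_fromUnitFiber adj₁ X

/-- The coreflection kills `X` exactly when `X ⟶ i (q X)` is an isomorphism. -/
theorem essImage_eq_kernel_kernelCoreflection :
    i.essImage = (kernelCoreflection adj₁ P hP).kernel := by
  ext X
  rw [← adj₁.isIso_unit_app_iff_mem_essImage]
  exact (Triangle.isZero₁_iff_isIso₂ _ (unitFiber_distinguished adj₁ X)).symm.trans
    (isZero_obj_iff ((kernelCoreflection adj₁ P hP).obj X))

noncomputable instance [P.IsTriangulated] : (kernelCoreflection adj₁ P hP).CommShift ℤ :=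
  (kernelCoreflectionAdjunction adj₁ P hP).rightAdjointCommShift ℤ

instance [P.IsTriangulated] : (kernelCoreflectionAdjunction adj₁ P hP).CommShift ℤ :=
  (kernelCoreflectionAdjunction adj₁ P hP).commShift_of_leftAdjoint ℤ

instance [P.IsTriangulated] : (kernelCoreflectionAdjunction adj₁ P hP).IsTriangulated :=
  Adjunction.IsTriangulated.mk' _

variable [p.CommShift ℤ] (adj₂ : i ⊣ p) [adj₂.IsTriangulated]

/-- For `Y` in the kernel of `q`, maps into the cone of `i (p Y) ⟶ Y` are maps to `Y` from the
coreflection onto the kernel of `q`. -/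
noncomputable def homCounitConeEquiv (X : T) (Y : P.FullSubcategory) :
    ((kernelCoreflection adj₁ P hP).obj X ⟶ Y) ≃ (X ⟶ counitCone adj₂ Y.obj) :=
  (fullSubcategoryHomEquiv _ _).trans ((postcompEquiv _ (trW_toCounitCone adj₂ Y.obj)
    (leftOrthogonal_essImage_of_eq_kernel adj₁ hP
      (((kernelCoreflection adj₁ P hP).obj X).property))).trans
    (precompEquiv _ (trW_kernelCoreflectionAdjunction_counit_app adj₁ P hP X)
      (rightOrthogonal_essImage_of_eq_kernel adj₂ rfl (kernel_counitCone adj₂ Y.obj))).symm)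

/-- The bijection `homCounitConeEquiv` is characterized by the square formed with the coreflection
map of `X` and the map from `Y` to its cone. -/
theorem counit_app_homCounitConeEquiv (X : T) (Y : P.FullSubcategory)
    (g : (kernelCoreflection adj₁ P hP).obj X ⟶ Y) :
    (kernelCoreflectionAdjunction adj₁ P hP).counit.app X ≫
      homCounitConeEquiv adj₁ P hP adj₂ X Y g = g.hom ≫ toCounitCone adj₂ Y.obj :=
  (precompEquiv _ (trW_kernelCoreflectionAdjunction_counit_app adj₁ P hP X)
    (rightOrthogonal_essImage_of_eq_kernel adj₂ rfl
      (kernel_counitCone adj₂ Y.obj))).apply_symm_apply _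

/-- The functor `Y ↦ cone (i (p Y) ⟶ Y)` on the kernel of `q`. -/
noncomputable def kernelCoreflectionRightAdjoint : P.FullSubcategory ⥤ T :=
  Adjunction.rightAdjointOfEquiv (F := kernelCoreflection adj₁ P hP)
    (homCounitConeEquiv adj₁ P hP adj₂)
    (fun X' X Y f g ↦ by
      apply (precompEquiv _ (trW_kernelCoreflectionAdjunction_counit_app adj₁ P hP X')
        (rightOrthogonal_essImage_of_eq_kernel adj₂ rfl
          (kernel_counitCone adj₂ Y.obj))).injective
      have hnat := (kernelCoreflectionAdjunction adj₁ P hP).counit.naturality f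
      calc
        _ = ((kernelCoreflection adj₁ P hP).map f ≫ g).hom ≫ toCounitCone adj₂ Y.obj :=
          counit_app_homCounitConeEquiv adj₁ P hP adj₂ X' Y _
        _ = ((kernelCoreflection adj₁ P hP).map f).hom ≫
            (kernelCoreflectionAdjunction adj₁ P hP).counit.app X ≫
              homCounitConeEquiv adj₁ P hP adj₂ X Y g := by
          rw [counit_app_homCounitConeEquiv]
          exact Category.assoc _ _ _
        _ = (((kernelCoreflection adj₁ P hP).map f).hom ≫
            (kernelCoreflectionAdjunction adj₁ P hP).counit.app X) ≫
              homCounitConeEquiv adj₁ P hP adj₂ X Y g := (Category.assoc _ _ _).symm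
        _ = ((kernelCoreflectionAdjunction adj₁ P hP).counit.app X' ≫ f) ≫
              homCounitConeEquiv adj₁ P hP adj₂ X Y g := congr_arg (· ≫ _) hnat
        _ = _ := Category.assoc _ _ _)

/-- The coreflection onto the kernel of `q` has a right adjoint. -/
noncomputable def kernelCoreflectionRightAdjunction :
    kernelCoreflection adj₁ P hP ⊣ kernelCoreflectionRightAdjoint adj₁ P hP adj₂ :=
  Adjunction.adjunctionOfEquivRight _ _

noncomputable instance [P.IsTriangulated] :
    (kernelCoreflectionRightAdjoint adj₁ P hP adj₂).CommShift ℤ :=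
  (kernelCoreflectionRightAdjunction adj₁ P hP adj₂).rightAdjointCommShift ℤ

instance [P.IsTriangulated] : (kernelCoreflectionRightAdjunction adj₁ P hP adj₂).CommShift ℤ :=
  (kernelCoreflectionRightAdjunction adj₁ P hP adj₂).commShift_of_leftAdjoint ℤ

instance [P.IsTriangulated] :
    (kernelCoreflectionRightAdjunction adj₁ P hP adj₂).IsTriangulated :=
  Adjunction.IsTriangulated.mk' _

/-- The recollement on an adjoint triple `q ⊣ i ⊣ p` of triangulated functors with `i` fully
faithful, whose third term is the kernel of `q`. -/
noncomputable def leftKernelRecollement [P.IsTriangulated] :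
    TriangulatedRecollement U T P.FullSubcategory :=
  have ff := (Adjunction.Triple.mk (kernelCoreflectionAdjunction adj₁ P hP)
    (kernelCoreflectionRightAdjunction adj₁ P hP adj₂)).fullyFaithfulEquiv P.fullyFaithfulι
  { q := q
    i := i
    p := p
    l := P.ι
    e := kernelCoreflection adj₁ P hP
    r := kernelCoreflectionRightAdjoint adj₁ P hP adj₂
    adj_q_i := adj₁
    adj_i_p := adj₂
    adj_l_e := kernelCoreflectionAdjunction adj₁ P hP
    adj_e_r := kernelCoreflectionRightAdjunction adj₁ P hP adj₂
    adj_q_i_isTriangulated := inferInstance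
    adj_i_p_isTriangulated := inferInstance
    adj_l_e_isTriangulated := inferInstance
    adj_e_r_isTriangulated := inferInstance
    i_full := inferInstance
    i_faithful := inferInstance
    l_full := inferInstance
    l_faithful := inferInstance
    r_full := ff.full
    r_faithful := ff.faithful
    essImage_i_eq_kernel_e := essImage_eq_kernel_kernelCoreflection adj₁ P hP }

end KernelLeft

end Triangulated

/-! ### Restriction of recollements to full subcategories -/

section Restrict

theorem shiftIso_refl {C : Type u₁} {D : Type u₂} [Category.{v₁} C] [Category.{v₂} D]
    [HasShift C ℤ] [HasShift D ℤ] (F : C ⥤ D) [F.CommShift ℤ] : ShiftIso F F :=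
  ⟨Iso.refl _, inferInstanceAs (NatTrans.CommShift (𝟙 F) ℤ)⟩

variable {C : Type u₁} {D : Type u₂} [Category.{v₁} C] [Category.{v₂} D]
  [HasShift C ℤ] [HasShift D ℤ]

/-- The restriction of a functor to full subcategories. -/
abbrev restrictFunctor (P : ObjectProperty C) (Q : ObjectProperty D) (F : C ⥤ D)
    (hF : ∀ X, P X → Q (F.obj X)) : P.FullSubcategory ⥤ Q.FullSubcategory :=
  Q.lift (P.ι ⋙ F) fun X ↦ hF X.obj X.property

variable (P : ObjectProperty C) (Q : ObjectProperty D)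

/-- The restriction of an adjunction to full subcategories. -/
noncomputable def restrictAdjunction {F : C ⥤ D} {G : D ⥤ C} (adj : F ⊣ G)
    (hF : ∀ X, P X → Q (F.obj X)) (hG : ∀ Y, Q Y → P (G.obj Y)) :
    restrictFunctor P Q F hF ⊣ restrictFunctor Q P G hG :=
  adj.restrictFullyFaithful P.fullyFaithfulι Q.fullyFaithfulι
    (Q.liftCompιIso _ _).symm (P.liftCompιIso _ _).symm

variable [P.IsStableUnderShift ℤ] [Q.IsStableUnderShift ℤ]

theorem shiftIso_restrictFunctor (F : C ⥤ D) [F.CommShift ℤ] (hF : ∀ X, P X → Q (F.obj X)) :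
    ShiftIso (restrictFunctor P Q F hF ⋙ Q.ι) (P.ι ⋙ F) :=
  ⟨Q.liftCompιIso _ _, inferInstance⟩

instance {F : C ⥤ D} {G : D ⥤ C} (adj : F ⊣ G) [F.CommShift ℤ] [G.CommShift ℤ]
    [adj.CommShift ℤ] (hF : ∀ X, P X → Q (F.obj X)) (hG : ∀ Y, Q Y → P (G.obj Y)) :
    (restrictAdjunction P Q adj hF hG).CommShift ℤ := by
  have h : Functor.whiskerRight (restrictAdjunction P Q adj hF hG).unit P.ι =
      (Functor.leftUnitor _).hom ≫ (Functor.rightUnitor _).inv ≫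
      Functor.whiskerLeft P.ι adj.unit ≫ (Functor.associator _ _ _).inv ≫
      Functor.whiskerRight (Q.liftCompιIso (P.ι ⋙ F) fun X ↦ hF X.obj X.property).inv G ≫
      (Functor.associator _ _ _).hom ≫
      Functor.whiskerLeft (restrictFunctor P Q F hF)
        (P.liftCompιIso (Q.ι ⋙ G) fun X ↦ hG X.obj X.property).inv ≫
      (Functor.associator _ _ _).inv := by
    ext X
    simp only [restrictAdjunction, Functor.whiskerRight_app,
      Adjunction.map_restrictFullyFaithful_unit_app]
    simp
  have : NatTrans.CommShift
      (Functor.whiskerRight (restrictAdjunction P Q adj hF hG).unit P.ι) ℤ := by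
    rw [h]
    infer_instance
  exact Adjunction.CommShift.mk' _ _
    (natTransCommShift_of_whiskerRight (restrictAdjunction P Q adj hF hG).unit P.ι)

end Restrict

section RestrictsTo

variable {U : Type u₁} {T : Type u₂} {V : Type u₃}
  [Category.{v₁} U] [Category.{v₂} T] [Category.{v₃} V]
  [HasShift U ℤ] [HasShift T ℤ] [HasShift V ℤ]
  [Preadditive U] [Preadditive T] [Preadditive V]
  [HasZeroObject U] [HasZeroObject T] [HasZeroObject V]
  [∀ n : ℤ, (shiftFunctor U n).Additive] [∀ n : ℤ, (shiftFunctor T n).Additive]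
  [∀ n : ℤ, (shiftFunctor V n).Additive]
  [Pretriangulated U] [Pretriangulated T] [Pretriangulated V]

instance (P : ObjectProperty U) (Q : ObjectProperty T) [P.IsTriangulated] [Q.IsTriangulated]
    {F : U ⥤ T} {G : T ⥤ U} (adj : F ⊣ G) [F.CommShift ℤ] [G.CommShift ℤ]
    [adj.IsTriangulated] (hF : ∀ X, P X → Q (F.obj X)) (hG : ∀ Y, Q Y → P (G.obj Y)) :
    (restrictAdjunction P Q adj hF hG).IsTriangulated where

/-- A recollement restricts to full triangulated subcategories which are preserved by its six
functors. -/
theorem TriangulatedRecollement.restrictsTo (R : TriangulatedRecollement U T V)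
    (PU : ObjectProperty U) (PT : ObjectProperty T) (PV : ObjectProperty V)
    [PU.IsTriangulated] [PT.IsTriangulated] [PV.IsTriangulated]
    [PU.IsClosedUnderIsomorphisms]
    (hq : ∀ X, PT X → PU (R.q.obj X)) (hi : ∀ X, PU X → PT (R.i.obj X))
    (hp : ∀ X, PT X → PU (R.p.obj X)) (hl : ∀ X, PV X → PT (R.l.obj X))
    (he : ∀ X, PT X → PV (R.e.obj X)) (hr : ∀ X, PV X → PT (R.r.obj X)) :
    R.RestrictsTo PU PT PV := by
  have := R.adj_q_i_isTriangulated
  have := R.adj_i_p_isTriangulated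
  have := R.adj_l_e_isTriangulated
  have := R.adj_e_r_isTriangulated
  have := R.i_full
  have := R.i_faithful
  have := R.l_full
  have := R.l_faithful
  have := R.r_full
  have := R.r_faithful
  refine ⟨
    { q := restrictFunctor PT PU R.q hq
      i := restrictFunctor PU PT R.i hi
      p := restrictFunctor PT PU R.p hp
      l := restrictFunctor PV PT R.l hl
      e := restrictFunctor PT PV R.e he
      r := restrictFunctor PV PT R.r hr
      adj_q_i := restrictAdjunction PT PU R.adj_q_i hq hi
      adj_i_p := restrictAdjunction PU PT R.adj_i_p hi hp
      adj_l_e := restrictAdjunction PV PT R.adj_l_e hl he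
      adj_e_r := restrictAdjunction PT PV R.adj_e_r he hr
      adj_q_i_isTriangulated := inferInstance
      adj_i_p_isTriangulated := inferInstance
      adj_l_e_isTriangulated := inferInstance
      adj_e_r_isTriangulated := inferInstance
      i_full := inferInstance
      i_faithful := inferInstance
      l_full := inferInstance
      l_faithful := inferInstance
      r_full := inferInstance
      r_faithful := inferInstance
      essImage_i_eq_kernel_e := ?_ },
    shiftIso_restrictFunctor _ _ _ hq, shiftIso_restrictFunctor _ _ _ hi,
    shiftIso_restrictFunctor _ _ _ hp, shiftIso_restrictFunctor _ _ _ hl,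
    shiftIso_restrictFunctor _ _ _ he, shiftIso_restrictFunctor _ _ _ hr⟩
  ext X
  have hX : R.i.essImage X.obj ↔ IsZero (R.e.obj X.obj) := by
    rw [R.essImage_i_eq_kernel_e]
    rfl
  refine Iff.trans ?_ (hX.trans (isZero_obj_iff ((restrictFunctor PT PV R.e he).obj X)))
  constructor
  · rintro ⟨Y, ⟨e⟩⟩
    exact ⟨Y.obj, ⟨PT.ι.mapIso e⟩⟩
  · rintro ⟨Y, ⟨e⟩⟩
    -- `Y` is isomorphic to `R.p (R.i Y)`, and `R.i Y` to `X`, which has the property `PT`.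
    have hY : PU Y := PU.prop_of_iso
      (R.p.mapIso e.symm ≪≫ (asIso (R.adj_i_p.unit.app Y)).symm) (hp _ X.property)
    exact ⟨⟨Y, hY⟩, ⟨PT.fullyFaithfulι.preimageIso e⟩⟩

end RestrictsTo

/-! ### Torsion pairs generated or cogenerated by a class of objects -/

section TorsionPair

variable {B : Type u₂} [Category.{v₂} B] [Abelian B]

/-- In a well-powered abelian category with coproducts, the left orthogonal of any class of objects
is a torsion class, since it is closed under quotients, extensions and coproducts: the torsion part
of `M` is the sum of all subobjects of `M` belonging to it. -/
theorem isTorsionPair_leftOrthogonal [HasCoproducts.{v₂} B] [WellPowered.{v₂} B]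
    (Q : ObjectProperty B) :
    IsTorsionPair Q.leftOrthogonal Q.leftOrthogonal.rightOrthogonal where
  hom_eq_zero _ _ f hM hN := hN f hM
  exists_shortExact M := by
    have : Small.{v₂} (Subobject M) := WellPowered.subobject_small M
    let J := {S : Subobject M // Q.leftOrthogonal (S : B)}
    have : Small.{v₂} J := inferInstance
    let X : Shrink.{v₂} J → B := fun j ↦ (((equivShrink J).symm j).1 : B)
    let f : (∐ X) ⟶ M := Sigma.desc fun j ↦ ((equivShrink J).symm j).1.arrow
    have hf : f ≫ cokernel.π (image.ι f) = 0 :=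
      (congr_arg (· ≫ cokernel.π (image.ι f)) (image.fac f)).symm.trans
        ((Category.assoc _ _ _).trans (by rw [cokernel.condition, comp_zero]))
    -- A quotient of a coproduct of left orthogonal objects is left orthogonal.
    have hN : Q.leftOrthogonal (image f) := fun Y g hY ↦ by
      rw [← cancel_epi (factorThruImage f), comp_zero]
      refine Sigma.hom_ext _ _ fun j ↦ ?_
      rw [comp_zero]
      exact ((equivShrink J).symm j).2 _ hY
    -- The image in `M` of an object left orthogonal to `Q` is one of the subobjects in `J`.
    have hfac {E : B} (hE : Q.leftOrthogonal E) (g : E ⟶ M) :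
        g ≫ cokernel.π (image.ι f) = 0 := by
      have hI : Q.leftOrthogonal (Subobject.mk (image.ι g) : B) := fun Y k hY ↦ by
        rw [← cancel_epi (Subobject.underlyingIso (image.ι g)).inv,
          ← cancel_epi (factorThruImage g), comp_zero, comp_zero]
        exact hE _ hY
      let j : Shrink.{v₂} J := equivShrink J ⟨Subobject.mk (image.ι g), hI⟩
      have hj : (Subobject.mk (image.ι g)).arrow ≫ cokernel.π (image.ι f) = 0 := by
        have h₁ : Sigma.ι X j ≫ f = ((equivShrink J).symm j).1.arrow := by simp [f]
        have h₂ : ((equivShrink J).symm j).1.arrow ≫ cokernel.π (image.ι f) = 0 := by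
          rw [← h₁, Category.assoc, hf, comp_zero]
        rwa [Equiv.symm_apply_apply] at h₂
      rw [← image.fac g, ← Subobject.underlyingIso_arrow (image.ι g), Category.assoc,
        Category.assoc, hj, comp_zero, comp_zero]
    refine ⟨image f, cokernel (image.ι f), image.ι f, cokernel.π (image.ι f), by simp, hN, ?_, ?_⟩
    · intro Z h hZ
      -- With `N = image f`, the pullback along `h` of the extension `M` of `M / N` by `N` is an
      -- extension of `Z` by `N`. So it is left orthogonal to `Q`, and its map to `M` lands in `N`.
      let E := pullback (cokernel.π (image.ι f)) h
      have hE : Q.leftOrthogonal E := fun Y g hY ↦ by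
        let j : image f ⟶ E := pullback.lift (image.ι f) 0 (by simp)
        let t : kernel (pullback.snd (cokernel.π (image.ι f)) h) ⟶ image f :=
          Abelian.monoLift (image.ι f) (kernel.ι _ ≫ pullback.fst _ _) (by
            rw [Category.assoc, pullback.condition, kernel.condition_assoc, zero_comp])
        have ht : t ≫ j = kernel.ι _ := by
          apply pullback.hom_ext
          · rw [Category.assoc, pullback.lift_fst, Abelian.monoLift_comp]
          · rw [Category.assoc, pullback.lift_snd, comp_zero, kernel.condition]
        have hg : kernel.ι (pullback.snd (cokernel.π (image.ι f)) h) ≫ g = 0 := by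
          rw [← ht, Category.assoc, hN (j ≫ g) hY, comp_zero]
        rw [← Abelian.comp_epiDesc (pullback.snd (cokernel.π (image.ι f)) h) g hg,
          hZ (Abelian.epiDesc _ g hg) hY, comp_zero]
      rw [← cancel_epi (pullback.snd (cokernel.π (image.ι f)) h), ← pullback.condition,
        hfac hE, comp_zero]
    · exact
        { exact := ShortComplex.exact_cokernel (image.ι f)
          mono_f := inferInstanceAs (Mono (image.ι f))
          epi_g := inferInstanceAs (Epi (cokernel.π (image.ι f))) }

/-- In a well-powered abelian category with products, the right orthogonal of any class of objects
is a torsion-free class, by `isTorsionPair_leftOrthogonal` in the opposite category. -/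
theorem isTorsionPair_rightOrthogonal [HasProducts.{v₂} B] [WellPowered.{v₂} B]
    (Q : ObjectProperty B) :
    IsTorsionPair Q.rightOrthogonal.leftOrthogonal Q.rightOrthogonal where
  hom_eq_zero _ _ f hM hN := hM f hN
  exists_shortExact M := by
    have : HasCoproducts.{v₂} Bᵒᵖ := fun J ↦ inferInstance
    obtain ⟨M', M'', f, g, w, h', h'', h⟩ :=
      (isTorsionPair_leftOrthogonal Q.op).exists_shortExact (Opposite.op M)
    refine ⟨M''.unop, M'.unop, g.unop, f.unop, congr_arg Quiver.Hom.unop w, fun Y k hY ↦ ?_,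
      fun Y k hY ↦ ?_, h.unop⟩
    · exact congr_arg Quiver.Hom.unop (h'' k.op fun Z t hZ ↦
        congr_arg Quiver.Hom.op (hY t.unop hZ))
    · exact congr_arg Quiver.Hom.unop (h' k.op hY)

end TorsionPair

/-! ### The kernel recollement of an adjoint triple of abelian categories -/

section KernelRecollement

variable {B : Type u₂} {C : Type u₃} [Category.{v₂} B] [Category.{v₃} C] [Abelian B] [Abelian C]
  {l : C ⥤ B} {e : B ⥤ C} {r : C ⥤ B}

/-- A functor with adjoints on both sides is exact. -/
theorem isExactFunctor_of_adjunctions [e.Additive] (adj₁ : l ⊣ e) (adj₂ : e ⊣ r) :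
    IsExactFunctor e where
  additive := inferInstance
  preservesFiniteLimits := by
    have := adj₁.rightAdjoint_preservesLimits
    infer_instance
  preservesFiniteColimits := by
    have := adj₂.leftAdjoint_preservesColimits
    infer_instance

section

variable [IsExactFunctor e] (adj : l ⊣ e) [l.Full] [l.Faithful]

theorem kernel_cokernel_counit (X : B) : e.kernel (cokernel (adj.counit.app X)) :=
  (isZero_cokernel_of_epi (e.map (adj.counit.app X))).of_iso
    (PreservesCokernel.iso e (adj.counit.app X))

/-- Maps from `X` to an object of the kernel of `e` factor uniquely through the cokernel of
`l (e X) ⟶ X`. -/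
noncomputable def cokernelCounitHomEquiv (X : B) (Y : e.kernel.FullSubcategory) :
    ((⟨cokernel (adj.counit.app X), kernel_cokernel_counit adj X⟩ :
      e.kernel.FullSubcategory) ⟶ Y) ≃ (X ⟶ e.kernel.ι.obj Y) where
  toFun f := cokernel.π _ ≫ f.hom
  invFun f := ObjectProperty.homMk (cokernel.desc _ f (by
    apply (adj.homEquiv _ _).injective
    exact IsZero.eq_of_tgt Y.property _ _))
  left_inv f := by ext; simp
  right_inv f := by simp

/-- The left adjoint of the inclusion of the kernel of `e`: the cokernel of `l (e X) ⟶ X`. -/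
noncomputable def abelianKernelReflection : B ⥤ e.kernel.FullSubcategory :=
  Adjunction.leftAdjointOfEquiv (G := e.kernel.ι) (cokernelCounitHomEquiv adj)
    fun _ _ _ _ _ ↦ (Category.assoc _ _ _).symm

/-- The adjunction exhibiting the kernel of `e` as a reflective subcategory. -/
noncomputable def abelianKernelReflectionAdjunction :
    abelianKernelReflection adj ⊣ e.kernel.ι :=
  Adjunction.adjunctionOfEquivLeft (G := e.kernel.ι) (cokernelCounitHomEquiv adj)
    fun _ _ _ _ _ ↦ (Category.assoc _ _ _).symm

end

section

variable [IsExactFunctor e] (adj : e ⊣ r) [r.Full] [r.Faithful]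

theorem kernel_kernel_unit (X : B) : e.kernel (kernel (adj.unit.app X)) :=
  (isZero_kernel_of_mono (e.map (adj.unit.app X))).of_iso
    (PreservesKernel.iso e (adj.unit.app X))

/-- Maps from an object of the kernel of `e` to `X` factor uniquely through the kernel of
`X ⟶ r (e X)`. -/
noncomputable def homKernelUnitEquiv (Y : e.kernel.FullSubcategory) (X : B) :
    (e.kernel.ι.obj Y ⟶ X) ≃ (Y ⟶ (⟨kernel (adj.unit.app X), kernel_kernel_unit adj X⟩ :
      e.kernel.FullSubcategory)) where
  toFun f := ObjectProperty.homMk (kernel.lift _ f (by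
    apply (adj.homEquiv _ _).symm.injective
    exact IsZero.eq_of_src Y.property _ _))
  invFun f := f.hom ≫ kernel.ι _
  left_inv f := by simp
  right_inv f := by ext; simp

/-- The right adjoint of the inclusion of the kernel of `e`: the kernel of `X ⟶ r (e X)`. -/
noncomputable def abelianKernelCoreflection : B ⥤ e.kernel.FullSubcategory :=
  Adjunction.rightAdjointOfEquiv (F := e.kernel.ι) (homKernelUnitEquiv adj)
    fun _ _ _ _ _ ↦ by ext; simp [homKernelUnitEquiv]

/-- The adjunction exhibiting the kernel of `e` as a coreflective subcategory. -/
noncomputable def abelianKernelCoreflectionAdjunction :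
    e.kernel.ι ⊣ abelianKernelCoreflection adj :=
  Adjunction.adjunctionOfEquivRight (F := e.kernel.ι) (homKernelUnitEquiv adj)
    fun _ _ _ _ _ ↦ by ext; simp [homKernelUnitEquiv]

end

/-- An adjoint triple `(l, e, r)` with `l` and `r` fully faithful is one half of a recollement: the
kernel of `e` is reflective and coreflective, by the cokernel of `l (e X) ⟶ X` and the kernel of
`X ⟶ r (e X)`. -/
theorem hasKernelRecollement [l.Additive] [e.Additive] [r.Additive] [l.Full] [l.Faithful]
    [r.Full] [r.Faithful] (adj₁ : l ⊣ e) (adj₂ : e ⊣ r) : HasKernelRecollement l e r := by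
  have he := isExactFunctor_of_adjunctions adj₁ adj₂
  exact ⟨he,
    { q := abelianKernelReflection adj₁
      i := e.kernel.ι
      p := abelianKernelCoreflection adj₂
      l := l
      e := e
      r := r
      q_additive := (abelianKernelReflectionAdjunction adj₁).left_adjoint_additive
      i_additive := inferInstance
      p_additive := (abelianKernelCoreflectionAdjunction adj₂).right_adjoint_additive
      l_additive := inferInstance
      e_additive := inferInstance
      r_additive := inferInstance
      adj_q_i := abelianKernelReflectionAdjunction adj₁
      adj_i_p := abelianKernelCoreflectionAdjunction adj₂
      adj_l_e := adj₁
      adj_e_r := adj₂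
      i_full := inferInstance
      i_faithful := inferInstance
      l_full := inferInstance
      l_faithful := inferInstance
      r_full := inferInstance
      r_faithful := inferInstance
      essImage_i_eq_kernel_e := by
        ext X
        exact ⟨fun ⟨Y, ⟨f⟩⟩ ↦ e.kernel.prop_of_iso f Y.property,
          fun h ↦ ⟨⟨X, h⟩, ⟨Iso.refl _⟩⟩⟩ },
    rfl, rfl, rfl, rfl⟩

end KernelRecollement

/-! ### Derived recollements of an adjoint triple containing `e` -/

section Derived

variable {A : Type u₁} {B : Type u₂} {C : Type u₃}
  [Category.{v₁} A] [Category.{v₂} B] [Category.{v₃} C] [Abelian A] [Abelian B] [Abelian C]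
  [HasDerivedCategory.{w₂} B] [HasDerivedCategory.{w₃} C] (R : AbelianRecollement A B C)

/-- If `q ⊣ i ⊣ e` are exact and `i` is fully faithful, the induced functors extend to a recollement
whose third term is the kernel `D_A(B)` of the functor induced by `e`. -/
theorem inducesDerivedRecollement_left {q : B ⥤ C} {i : C ⥤ B} [IsExactFunctor q]
    [IsExactFunctor i] [i.Full] [i.Faithful] (adj₁ : q ⊣ i) (adj₂ : i ⊣ R.e) :
    InducesDerivedRecollement R q i R.e := by
  have he := R.isExactFunctor_e
  have ff := fullyFaithfulMapDerivedCategory adj₁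
  have := ff.full
  have := ff.faithful
  refine ⟨inferInstance, inferInstance, he,
    rightKernelRecollement (mapDerivedCategoryAdjunction adj₂) (cohomologyIn R)
      (cohomologyIn_eq_kernel R) (mapDerivedCategoryAdjunction adj₁),
    shiftIso_refl _, shiftIso_refl _, shiftIso_refl _,
    TriangulatedRecollement.restrictsTo _ _ _ _ (boundedObjects_mapDerivedCategory q)
      (boundedObjects_mapDerivedCategory i) (boundedObjects_mapDerivedCategory R.e) ?_ ?_ ?_⟩
  · exact fun X hX ↦ prop_unitFiber (mapDerivedCategoryAdjunction adj₁) (boundedObjects B)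
      (boundedObjects_mapDerivedCategory i _ (boundedObjects_mapDerivedCategory q _ hX)) hX
  · exact fun X hX ↦ prop_counitCone (mapDerivedCategoryAdjunction adj₂) (boundedObjects B)
      (boundedObjects_mapDerivedCategory i _ (boundedObjects_mapDerivedCategory R.e _ hX)) hX
  · exact fun X hX ↦ hX

/-- If `e ⊣ i ⊣ p` are exact and `i` is fully faithful, the induced functors extend to a recollement
whose third term is the kernel `D_A(B)` of the functor induced by `e`. -/
theorem inducesDerivedRecollement_right {i : C ⥤ B} {p : B ⥤ C} [IsExactFunctor i]
    [IsExactFunctor p] [i.Full] [i.Faithful] (adj₁ : R.e ⊣ i) (adj₂ : i ⊣ p) :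
    InducesDerivedRecollement R R.e i p := by
  have he := R.isExactFunctor_e
  have ff := fullyFaithfulMapDerivedCategory adj₁
  have := ff.full
  have := ff.faithful
  refine ⟨he, inferInstance, inferInstance,
    leftKernelRecollement (mapDerivedCategoryAdjunction adj₁) (cohomologyIn R)
      (cohomologyIn_eq_kernel R) (mapDerivedCategoryAdjunction adj₂),
    shiftIso_refl _, shiftIso_refl _, shiftIso_refl _,
    TriangulatedRecollement.restrictsTo _ _ _ _ (boundedObjects_mapDerivedCategory R.e)
      (boundedObjects_mapDerivedCategory i) (boundedObjects_mapDerivedCategory p) ?_ ?_ ?_⟩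
  · exact fun X hX ↦ hX
  · exact fun X hX ↦ prop_unitFiber (mapDerivedCategoryAdjunction adj₁) (boundedObjects B)
      (boundedObjects_mapDerivedCategory i _ (boundedObjects_mapDerivedCategory R.e _ hX)) hX
  · exact fun X hX ↦ prop_counitCone (mapDerivedCategoryAdjunction adj₂) (boundedObjects B)
      (boundedObjects_mapDerivedCategory i _ (boundedObjects_mapDerivedCategory p _ hX)) hX

end Derived

/-! ### Ladders of height two and three -/

section Ladders

variable {A : Type u₁} {B : Type u₂} {C : Type u₃}
  [Category.{v₁} A] [Category.{v₂} B] [Category.{v₃} C] [Abelian A] [Abelian B] [Abelian C]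
  {R : AbelianRecollement A B C}

theorem LeftLadder.isTorsionPair [HasCoproducts.{v₂} B] [WellPowered.{v₂} B]
    (L : LeftLadder R 2) : IsTorsionPair (L.odd 0).kernel (L.odd 0).kernel.rightOrthogonal := by
  rw [← leftOrthogonal_essImage (L.adj_odd 0 (by norm_num))]
  exact isTorsionPair_leftOrthogonal _

theorem RightLadder.isTorsionPair [HasProducts.{v₂} B] [WellPowered.{v₂} B]
    (L : RightLadder R 2) : IsTorsionPair (L.odd 0).kernel.leftOrthogonal (L.odd 0).kernel := by
  rw [← rightOrthogonal_essImage (L.adj_odd 0 (by norm_num))]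
  exact isTorsionPair_rightOrthogonal _

theorem LeftLadder.hasKernelRecollement (L : LeftLadder R 3) :
    HasKernelRecollement (L.even 1) (L.odd 0) (L.even 0) := by
  have adj₁ : L.even 1 ⊣ L.odd 0 := L.adj_even 0 (by norm_num)
  have adj₂ : L.odd 0 ⊣ L.even 0 := L.adj_odd 0 (by norm_num)
  have : (L.even 1).Additive := L.evenSucc_additive 0 (by norm_num)
  have : (L.odd 0).Additive := L.odd_additive 0 (by norm_num)
  have : (L.even 0).Additive := R.l_additive
  have : (L.even 0).Full := R.l_full
  have : (L.even 0).Faithful := R.l_faithful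
  -- The outer functors of an adjoint triple are fully faithful simultaneously.
  have ff := (Adjunction.Triple.mk adj₁ adj₂).fullyFaithfulEquiv.symm (.ofFullyFaithful _)
  have := ff.full
  have := ff.faithful
  exact RecollementLadder.hasKernelRecollement adj₁ adj₂

theorem RightLadder.hasKernelRecollement (L : RightLadder R 3) :
    HasKernelRecollement (L.even 0) (L.odd 0) (L.even 1) := by
  have adj₁ : L.even 0 ⊣ L.odd 0 := L.adj_odd 0 (by norm_num)
  have adj₂ : L.odd 0 ⊣ L.even 1 := L.adj_even 0 (by norm_num)
  have : (L.even 1).Additive := L.evenSucc_additive 0 (by norm_num)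
  have : (L.odd 0).Additive := L.odd_additive 0 (by norm_num)
  have : (L.even 0).Additive := R.r_additive
  have : (L.even 0).Full := R.r_full
  have : (L.even 0).Faithful := R.r_faithful
  -- The outer functors of an adjoint triple are fully faithful simultaneously.
  have ff := (Adjunction.Triple.mk adj₁ adj₂).fullyFaithfulEquiv (.ofFullyFaithful _)
  have := ff.full
  have := ff.faithful
  exact RecollementLadder.hasKernelRecollement adj₁ adj₂

variable [HasDerivedCategory.{w₂} B] [HasDerivedCategory.{w₃} C]

theorem LeftLadder.inducesDerivedRecollement (L : LeftLadder R 3) :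
    InducesDerivedRecollement R (L.odd 0) (L.even 0) R.e := by
  have adj₁ : L.even 1 ⊣ L.odd 0 := L.adj_even 0 (by norm_num)
  have adj₂ : L.odd 0 ⊣ L.even 0 := L.adj_odd 0 (by norm_num)
  have adj₃ : L.even 0 ⊣ R.e := R.adj_l_e
  have : (L.odd 0).Additive := L.odd_additive 0 (by norm_num)
  have : (L.even 0).Additive := R.l_additive
  have : (L.even 0).Full := R.l_full
  have : (L.even 0).Faithful := R.l_faithful
  have := isExactFunctor_of_adjunctions adj₁ adj₂
  have := isExactFunctor_of_adjunctions adj₂ adj₃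
  exact inducesDerivedRecollement_left R adj₂ adj₃

theorem RightLadder.inducesDerivedRecollement (L : RightLadder R 3) :
    InducesDerivedRecollement R R.e (L.even 0) (L.odd 0) := by
  have adj₁ : R.e ⊣ L.even 0 := R.adj_e_r
  have adj₂ : L.even 0 ⊣ L.odd 0 := L.adj_odd 0 (by norm_num)
  have adj₃ : L.odd 0 ⊣ L.even 1 := L.adj_even 0 (by norm_num)
  have : (L.odd 0).Additive := L.odd_additive 0 (by norm_num)
  have : (L.even 0).Additive := R.r_additive
  have : (L.even 0).Full := R.r_full
  have : (L.even 0).Faithful := R.r_faithful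
  have := isExactFunctor_of_adjunctions adj₁ adj₂
  have := isExactFunctor_of_adjunctions adj₂ adj₃
  exact inducesDerivedRecollement_right R adj₁ adj₂

end Ladders

end RecollementLadder

theorem proposition4
    {A : Type u₁} {B : Type u₂} {C : Type u₃}
    [Category.{v₁} A] [Category.{v₂} B] [Category.{v₃} C] [Abelian A] [Abelian B] [Abelian C]
    [HasDerivedCategory.{w₂} B] [HasDerivedCategory.{w₃} C]
    (R : RecollementLadder.AbelianRecollement A B C) :
    (∀ [HasCoproducts.{v₂} B] [WellPowered.{v₂} B] (L : RecollementLadder.LeftLadder R 2),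
      RecollementLadder.IsTorsionPair (L.odd 0).kernel (L.odd 0).kernel.rightOrthogonal) ∧
    (∀ L : RecollementLadder.LeftLadder R 3,
      RecollementLadder.HasKernelRecollement (L.even 1) (L.odd 0) (L.even 0) ∧
      RecollementLadder.InducesDerivedRecollement R (L.odd 0) (L.even 0) R.e) ∧
    (∀ [HasProducts.{v₂} B] [WellPowered.{v₂} B] (L : RecollementLadder.RightLadder R 2),
      RecollementLadder.IsTorsionPair (L.odd 0).kernel.leftOrthogonal (L.odd 0).kernel) ∧
    (∀ L : RecollementLadder.RightLadder R 3,
      RecollementLadder.HasKernelRecollement (L.even 0) (L.odd 0) (L.even 1) ∧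
      RecollementLadder.InducesDerivedRecollement R R.e (L.even 0) (L.odd 0)) :=
  ⟨fun L ↦ L.isTorsionPair, fun L ↦ ⟨L.hasKernelRecollement, L.inducesDerivedRecollement⟩,
    fun L ↦ L.isTorsionPair, fun L ↦ ⟨L.hasKernelRecollement, L.inducesDerivedRecollement⟩⟩
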